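/- Let $0<\alpha<2$. For a measure space $(S,\mu)$ let $L^\alpha_+(S,\mu)$ be the set of $f\in L^\alpha(S,\mu)$ (real-valued) with $f\ge 0$ $\mu$-a.e., and write $\|f\|_{L^\alpha(S,\mu)}=(\int_S|f|^\alpha d\mu)^{1/\alpha}$. An S$\alpha$S random variable $Z$ is one with $\mathbb E e^{-iuZ}=e^{-\sigma^\alpha|u|^\alpha}$, $u\in\mathbb R$, for some $\sigma\ge0$; an $\alpha$-Fréchet random variable $Z$ is a nonnegative one with $\mathbb P(Z\le y)=e^{-\sigma^\alpha y^{-\alpha}}$, $y>0$, for some $\sigma\ge 0$ (in both cases $\sigma=0$ is the degenerate case $Z=0$). Let $T$ be an arbitrary index set. A process $\{X_t\}_{t\in T}$ is S$\alpha$S if all finite linear combinations $\sum_j a_jX_{t_j}$, $a_j\in\mathbb R$, are S$\alpha$S; a process $\{Y_t\}_{t\in T}$ is $\alpha$-Fréchet if all finite max-linear combinations $\max_j a_jY_{t_j}$, $a_j\ge0$, are $\alpha$-Fréchet. For $\{f_t\}_{t\in T}\subset L^\alpha(S,\mu)$, the process $\{X_t\}$ has the (stable integral) representation $\{f_t\}$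 on $(S,\mu)$, i.e. it has the law of $\{\int_S f_t\,dM_{\alpha,+}\}_{t\in T}$ with $M_{\alpha,+}$ an S$\alpha$S random measure with control measure $\mu$, if for all $n$, $t_j\in T$, $a_j\in\mathbb R$, $$\mathbb E\exp\Big\{-i\sum_{j=1}^n a_jX_{t_j}\Big\}=\exp\Big\{-\int_S\Big|\sum_{j=1}^n a_jf_{t_j}\Big|^\alpha d\mu\Big\}.$$ For $\{f_t\}_{t\in T}\subset L^\alpha_+(S,\mu)$, the process $\{Y_t\}$ has the extremal integral representation $\{f_t\}$ on $(S,\mu)$ if all $Y_t\ge0$ a.s. and for all $n$, $t_j\in T$, $a_j>0$, $$\mathbb P(Y_{t_1}\le a_1,\dots,Y_{t_n}\le a_n)=\exp\Big\{-\int_S\Big(\max_{1\le j\le n}f_{t_j}/a_j\Big)^\alpha d\mu\Big\}.$$ An S$\alpha$S process $X$ and an $\alpha$-Fréchet process $Y$ indexed by $T$ are associated if there are a measure space $(S,\mu)$ and $\{f_t\}_{t\in T}\subset L^\alpha_+(S,\mu)$ such that $X$ has the stable integral representation $\{f_t\}$ and $Y$ has the extremal integral representation $\{f_t\}$. An S$\alpha$S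 process is max-associable if some $\alpha$-Fréchet process is associated with it. **Theorem.** 1. Let $(S_1,\mu_1)$ be a measure space, $n\in\mathbb N$ and $f_1,\dots,f_n\in L^\alpha(S_1,\mu_1)$. There exist a measure space $(S_2,\mu_2)$ and $g_1,\dots,g_n\in L^\alpha_+(S_2,\mu_2)$ with $$\Big\|\sum_{j=1}^n a_jf_j\Big\|_{L^\alpha(S_1,\mu_1)}=\Big\|\sum_{j=1}^n a_jg_j\Big\|_{L^\alpha(S_2,\mu_2)}\quad\text{for all }a_1,\dots,a_n\in\mathbb R$$ if and only if $f_if_j\ge0$ $\mu_1$-a.e. for all $1\le i,j\le n$. In that case one can take $(S_2,\mu_2)=(S_1,\mu_1)$ and $g_j=|f_j|$, $1\le j\le n$. 2. Let $X=\{X_t\}_{t\in T}$ be an S$\alpha$S process with stable integral representation $\{f_t\}_{t\in T}\subset L^\alpha(S,\mu)$. Then $X$ is max-associable if and only if $f_{t_1}f_{t_2}\ge0$ $\mu$-a.e. for all $t_1,t_2\in T$. -/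

import Mathlib

open MeasureTheory

universe u w v₁ v₂

/-- `g` is a family of functions in `L^α_+(S, μ)`: functions in `L^α(S, μ)` that are nonnegative
(almost everywhere, since functions are identified when they agree almost everywhere). -/
def IsNonnegLpFamily {ι S : Type*} [MeasurableSpace S] (α : ℝ) (μ : Measure S)
    (g : ι → S → ℝ) : Prop :=
  ∀ i, MemLp (g i) (ENNReal.ofReal α) μ ∧ 0 ≤ᵐ[μ] g i

/-- The families `f` on `(S₁, μ₁)` and `g` on `(S₂, μ₂)` have the same `L^α` norms of all
linear combinations: `‖∑ aⱼ fⱼ‖ = ‖∑ aⱼ gⱼ‖` for all real `a₁, …, aₙ`. -/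
def SameLinearNorms {n : ℕ} {S₁ S₂ : Type*} [MeasurableSpace S₁] [MeasurableSpace S₂] (α : ℝ)
    (μ₁ : Measure S₁) (f : Fin n → S₁ → ℝ) (μ₂ : Measure S₂) (g : Fin n → S₂ → ℝ) : Prop :=
  ∀ a : Fin n → ℝ,
    eLpNorm (fun s => ∑ j, a j * f j s) (ENNReal.ofReal α) μ₁ =
      eLpNorm (fun s => ∑ j, a j * g j s) (ENNReal.ofReal α) μ₂

/-- `Z` is a symmetric `α`-stable random variable: its characteristic function is
`exp(-σ^α |u|^α)` for a scale coefficient `σ ≥ 0` (`σ = 0` is the degenerate case `Z = 0`). -/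
def IsSymmStable {Ω : Type*} [MeasurableSpace Ω] (α : ℝ) (Z : Ω → ℝ) (P : Measure Ω) : Prop :=
  AEMeasurable Z P ∧ ∃ σ : ℝ, 0 ≤ σ ∧ ∀ u : ℝ,
    ∫ ω, Complex.exp (-(Complex.I * ((u * Z ω : ℝ) : ℂ))) ∂P =
      ((Real.exp (-(σ ^ α * |u| ^ α)) : ℝ) : ℂ)

/-- `X` is a symmetric `α`-stable process: every finite linear combination `∑ aⱼ X_{tⱼ}` is a
symmetric `α`-stable random variable. -/
def IsSymmStableProcess {T Ω : Type*} [MeasurableSpace Ω] (α : ℝ) (X : T → Ω → ℝ)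
    (P : Measure Ω) : Prop :=
  ∀ (n : ℕ) (t : Fin n → T) (a : Fin n → ℝ), IsSymmStable α (fun ω => ∑ j, a j * X (t j) ω) P

/-- `Z` is an `α`-Fréchet random variable: it is nonnegative and `P(Z ≤ y) = exp(-σ^α y^(-α))`
for all `y > 0`, with a scale coefficient `σ ≥ 0` (`σ = 0` is the degenerate case `Z = 0`). -/
def IsFrechet {Ω : Type*} [MeasurableSpace Ω] (α : ℝ) (Z : Ω → ℝ) (P : Measure Ω) : Prop :=
  AEMeasurable Z P ∧ 0 ≤ᵐ[P] Z ∧ ∃ σ : ℝ, 0 ≤ σ ∧ ∀ y : ℝ, 0 < y →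
    P {ω | Z ω ≤ y} = ENNReal.ofReal (Real.exp (-(σ ^ α * y ^ (-α))))

/-- `Y` is an `α`-Fréchet process: every finite max-linear combination `max_j aⱼ Y_{tⱼ}` with
`aⱼ ≥ 0` is an `α`-Fréchet random variable. -/
def IsFrechetProcess {T Ω : Type*} [MeasurableSpace Ω] (α : ℝ) (Y : T → Ω → ℝ)
    (P : Measure Ω) : Prop :=
  ∀ (n : ℕ) (t : Fin n → T) (a : Fin n → ℝ), (∀ j, 0 ≤ a j) →
    IsFrechet α (fun ω => ⨆ j, a j * Y (t j) ω) P

/-- `X` is equal in distribution to the process `{∫ f_t dM}` of stable integrals with respect to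
a symmetric `α`-stable random measure `M` with control measure `μ`. The process of stable
integrals is given by its finite-dimensional distributions, whose characteristic functions are
`E exp(-i ∑ aⱼ X_{tⱼ}) = exp(-∫ |∑ aⱼ f_{tⱼ}|^α dμ)`. -/
def HasStableRepresentation {T Ω S : Type*} [MeasurableSpace Ω] [MeasurableSpace S] (α : ℝ)
    (X : T → Ω → ℝ) (P : Measure Ω) (f : T → S → ℝ) (μ : Measure S) : Prop :=
  (∀ t, AEMeasurable (X t) P) ∧ (∀ t, MemLp (f t) (ENNReal.ofReal α) μ) ∧
    ∀ (n : ℕ) (t : Fin n → T) (a : Fin n → ℝ),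
      ∫ ω, Complex.exp (-(Complex.I * ((∑ j, a j * X (t j) ω : ℝ) : ℂ))) ∂P =
        ((Real.exp (-∫ s, |∑ j, a j * f (t j) s| ^ α ∂μ) : ℝ) : ℂ)

/-- `Y` is equal in distribution to the process of extremal integrals of the nonnegative
functions `f_t` with respect to an `α`-Fréchet random sup-measure with control measure `μ`. The
process of extremal integrals is given by its finite-dimensional distributions: it is
nonnegative, and `P(Y_{t₁} ≤ a₁, …, Y_{tₙ} ≤ aₙ) = exp(-∫ (max_j f_{tⱼ} / aⱼ)^α dμ)`. -/
def HasExtremalRepresentation {T Ω S : Type*} [MeasurableSpace Ω] [MeasurableSpace S] (α : ℝ)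
    (Y : T → Ω → ℝ) (P : Measure Ω) (f : T → S → ℝ) (μ : Measure S) : Prop :=
  (∀ t, AEMeasurable (Y t) P ∧ 0 ≤ᵐ[P] Y t) ∧ IsNonnegLpFamily α μ f ∧
    ∀ (n : ℕ) (t : Fin n → T) (a : Fin n → ℝ), (∀ j, 0 < a j) →
      P {ω | ∀ j, Y (t j) ω ≤ a j} =
        ENNReal.ofReal (Real.exp (-∫ s, (⨆ j, f (t j) s / a j) ^ α ∂μ))

/-- The symmetric `α`-stable process `X` and the `α`-Fréchet process `Y` are associated: some
family of nonnegative spectral functions represents both. -/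
def AreAssociated.{w', v₁', v₂', v₃'} {T : Type v₁'} {Ω : Type v₂'} {Ω' : Type v₃'}
    [MeasurableSpace Ω] [MeasurableSpace Ω'] (α : ℝ)
    (X : T → Ω → ℝ) (P : Measure Ω) (Y : T → Ω' → ℝ) (P' : Measure Ω') : Prop :=
  ∃ (S : Type w') (_ : MeasurableSpace S) (μ : Measure S) (f : T → S → ℝ),
    IsNonnegLpFamily α μ f ∧ HasStableRepresentation α X P f μ ∧
      HasExtremalRepresentation α Y P' f μ

/-- The symmetric `α`-stable process `X` is max-associable: there is an `α`-Fréchet process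
associated with it. (The probability space of `Y` is taken in the universe of `T`, which contains
the path space `T → ℝ` and hence a version of every real process indexed by `T`.) -/
def IsMaxAssociable.{w', v₁', v₂'} {T : Type v₁'} {Ω : Type v₂'} [MeasurableSpace Ω] (α : ℝ)
    (X : T → Ω → ℝ) (P : Measure Ω) : Prop :=
  ∃ (Ω' : Type v₁') (_ : MeasurableSpace Ω') (P' : Measure Ω') (Y : T → Ω' → ℝ),
    IsProbabilityMeasure P' ∧ IsFrechetProcess α Y P' ∧ AreAssociated.{w', v₁', v₂', v₁'} α X P Y P'

/-!
The question whether a family in `L^α` has the same norms of linear combinations as a nonnegative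
family is one about pairs, and is decided by the Lévy measure of the stable vector with spectral
functions `f₁, f₂`: the image `ν` of `u^{-1-α} μ(ds) du`, `u > 0`, under
`(s, u) ↦ (u f₁(s), u f₂(s))`. The functions have equal signs almost everywhere exactly when
`ν` does not charge `{z | z₁ z₂ < 0}`. For `0 < α < 2`, `|x|^α` is a multiple of
`∫₀^∞ (1 - cos (u x)) u^{-1-α} du`, so that the second difference in the direction `(1, 0)` of
`(a, b) ↦ ∫ |a f₁ + b f₂|^α dμ` is a multiple of
`∫ cos (a z₁ + b z₂) (1 - cos z₁) ν(dz)` (`integral_cos_weightedLevy`). This is the real part of the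
characteristic function of a finite measure; hence the norms determine the symmetrization of that
measure, and with it whether the signs are equal (`ae_mul_nonneg_of_integral_eq`). Conversely,
if all signs are equal then at almost every point the `f_j` are all `≥ 0` or all `≤ 0`, and passing
to `|f_j|` does not change the norms.

For stable processes the norms can be read off from the characteristic functions, which reduces the
second part to the first, except that an `α`-Fréchet process with spectral functions `g_t = |f_t|`
has to be constructed. For finitely many indices the index-`1` law is that of the coordinatewise
supremum of the points `g^α(s) / u` of a Poisson process on pairs `(s, u)`
(`exists_poissonMax`, `exists_extremalIntegral_of_finite`). These laws are consistent, and
Kolmogorov's theorem, proved here for compact state spaces, extends them to the path space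
`T → [0, ∞]` (`exists_extremalIntegral`). Taking values in `[0, ∞]` makes the suprema
unconditional and the state space compact. The power `1/α` of the coordinates is the wanted process
(`exists_hasExtremalRepresentation`).
-/

open Filter Set Topology
open scoped ENNReal NNReal

/-! ### Maxima of Poisson processes -/

/-- The function `x ↦ e^{-x}` on `[0, ∞]`, with `e^{-∞} = 0`. -/
noncomputable def expNeg (x : ℝ≥0∞) : ℝ≥0∞ := EReal.exp (-(x : EReal))

lemma expNeg_ofReal {x : ℝ} (hx : 0 ≤ x) :
    expNeg (ENNReal.ofReal x) = ENNReal.ofReal (Real.exp (-x)) := by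
  rw [expNeg, EReal.coe_ennreal_ofReal, max_eq_left hx, ← EReal.coe_neg, EReal.exp_coe]

@[simp] lemma expNeg_zero : expNeg 0 = 1 := by simp [expNeg]

lemma expNeg_add (x y : ℝ≥0∞) : expNeg (x + y) = expNeg x * expNeg y := by
  rw [expNeg, expNeg, expNeg, ← EReal.exp_add, EReal.coe_ennreal_add, EReal.neg_add, sub_eq_add_neg]
  · exact Or.inl (EReal.coe_ennreal_ne_bot x)
  · exact Or.inr (EReal.coe_ennreal_ne_bot y)

lemma continuous_expNeg : Continuous expNeg :=
  ENNReal.continuous_exp.comp (continuous_neg.comp continuous_coe_ennreal_ereal)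

lemma expNeg_sum {κ : Type*} (s : Finset κ) (x : κ → ℝ≥0∞) :
    expNeg (∑ i ∈ s, x i) = ∏ i ∈ s, expNeg (x i) := by
  classical
  induction s using Finset.induction_on with
  | empty => simp
  | insert a s ha ih => rw [Finset.sum_insert ha, Finset.prod_insert ha, expNeg_add, ih]

lemma tprod_expNeg {κ : Type*} (x : κ → ℝ≥0∞) : ∏' i, expNeg (x i) = expNeg (∑' i, x i) := by
  refine HasProd.tprod_eq ?_
  have h : HasSum x (∑' i, x i) := ENNReal.summable.hasSum
  have h' := (continuous_expNeg.tendsto _).comp h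
  simpa only [HasProd, Function.comp_def, expNeg_sum] using h'

lemma tsum_inv_factorial_mul_pow (p : ℝ≥0∞) (hp : p ≠ ∞) :
    ∑' m : ℕ, ((m.factorial : ℝ≥0∞))⁻¹ * p ^ m = ENNReal.ofReal (Real.exp p.toReal) := by
  rw [Real.exp_eq_exp_ℝ, NormedSpace.exp_eq_tsum_div,
    ENNReal.ofReal_tsum_of_nonneg (fun n => by positivity)
      (by simpa using Real.summable_pow_div_factorial p.toReal)]
  refine tsum_congr fun m => ?_
  rw [ENNReal.ofReal_div_of_pos (by positivity), ENNReal.ofReal_pow ENNReal.toReal_nonneg,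
    ENNReal.ofReal_toReal hp, ENNReal.ofReal_natCast, ENNReal.div_eq_inv_mul]

/-- The law `Q` is that of the coordinatewise maximum of the points of a Poisson process with finite
intensity measure `ρ`: the number `m` of points has a Poisson law of mean `ρ univ`, and given `m`
the points are independent with law proportional to `ρ`. -/
theorem exists_poissonMax_of_isFiniteMeasure {ι : Type*} [Countable ι] (ρ : Measure (ι → ℝ≥0∞))
    [IsFiniteMeasure ρ] :
    ∃ Q : Measure (ι → ℝ≥0∞), IsProbabilityMeasure Q ∧ ∀ a, Q (Iic a) = expNeg (ρ (Iic a)ᶜ) := by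
  have hsup (m : ℕ) : Measurable fun v : Fin m → ι → ℝ≥0∞ => ⨆ l, v l := by
    refine measurable_pi_lambda _ fun i => ?_
    simp only [iSup_apply]
    exact Measurable.iSup fun l => by fun_prop
  set Q : Measure (ι → ℝ≥0∞) := expNeg (ρ univ) • Measure.sum fun m : ℕ =>
    ((m.factorial : ℝ≥0∞))⁻¹ • (Measure.pi (fun _ : Fin m => ρ)).map (fun v => ⨆ l, v l) with hQ
  have key (a : ι → ℝ≥0∞) : Q (Iic a) = expNeg (ρ (Iic a)ᶜ) := by
    have h1 (m : ℕ) : (Measure.pi (fun _ : Fin m => ρ)).map (fun v => ⨆ l, v l) (Iic a)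
        = ρ (Iic a) ^ m := by
      rw [Measure.map_apply (hsup m) measurableSet_Iic]
      have : (fun v : Fin m → ι → ℝ≥0∞ => ⨆ l, v l) ⁻¹' Iic a = univ.pi fun _ => Iic a := by
        ext v; simp only [mem_preimage, mem_Iic, iSup_le_iff, mem_univ_pi]
      rw [this, Measure.pi_pi]; simp
    rw [hQ, Measure.smul_apply, Measure.sum_apply _ measurableSet_Iic]
    simp only [Measure.smul_apply, h1, smul_eq_mul]
    rw [tsum_inv_factorial_mul_pow _ (measure_ne_top _ _),
      measure_compl measurableSet_Iic (measure_ne_top _ _)]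
    have hle : ρ (Iic a) ≤ ρ univ := measure_mono (subset_univ _)
    rw [← ENNReal.ofReal_toReal (measure_ne_top ρ univ),
      ← ENNReal.ofReal_toReal (measure_ne_top ρ (Iic a)),
      ← ENNReal.ofReal_sub _ ENNReal.toReal_nonneg, expNeg_ofReal ENNReal.toReal_nonneg,
      expNeg_ofReal (sub_nonneg.2 (ENNReal.toReal_mono (measure_ne_top _ _) hle)),
      ENNReal.toReal_ofReal ENNReal.toReal_nonneg, ← ENNReal.ofReal_mul (Real.exp_nonneg _),
      ← Real.exp_add]
    ring_nf
  refine ⟨Q, ⟨?_⟩, key⟩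
  have := key ⊤
  simpa using this

/-- The coordinatewise supremum of the points of a Poisson process with s-finite intensity
measure `Λ`: all points are `≤ a` with probability `e^{-Λ{x | ¬ x ≤ a}}`. The process is the union
of countably many independent ones with finite intensities. -/
theorem exists_poissonMax {ι : Type*} [Countable ι] (Λ : Measure (ι → ℝ≥0∞)) [SFinite Λ] :
    ∃ Q : Measure (ι → ℝ≥0∞), IsProbabilityMeasure Q ∧ ∀ a, Q (Iic a) = expNeg (Λ (Iic a)ᶜ) := by
  choose q hq hqa using fun k => exists_poissonMax_of_isFiniteMeasure (sfiniteSeq Λ k)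
  have hsup : Measurable fun v : ℕ → ι → ℝ≥0∞ => ⨆ l, v l := by
    refine measurable_pi_lambda _ fun i => ?_
    simp only [iSup_apply]
    exact Measurable.iSup fun l => by fun_prop
  refine ⟨(Measure.infinitePi q).map (fun v => ⨆ l, v l),
    Measure.isProbabilityMeasure_map hsup.aemeasurable, fun a => ?_⟩
  rw [Measure.map_apply hsup measurableSet_Iic]
  have : (fun v : ℕ → ι → ℝ≥0∞ => ⨆ l, v l) ⁻¹' Iic a = univ.pi fun _ => Iic a := by
    ext v; simp only [mem_preimage, mem_Iic, iSup_le_iff, mem_univ_pi]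
  rw [this, Measure.infinitePi_pi_univ _ fun _ => measurableSet_Iic]
  simp only [hqa]
  rw [tprod_expNeg, ← Measure.sum_apply _ measurableSet_Iic.compl, sum_sfiniteSeq]

/-! ### Extension of consistent finite-dimensional laws -/

/-- A finite measure on `[0, ∞]^ι` is determined by its distribution function. -/
theorem ext_of_Iic_pi {ι : Type*} [Countable ι] {P Q : Measure (ι → ℝ≥0∞)}
    [IsFiniteMeasure P] (h : ∀ a, P (Iic a) = Q (Iic a)) : P = Q := by
  classical
  have hgen : (MeasurableSpace.pi : MeasurableSpace (ι → ℝ≥0∞)) =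
      MeasurableSpace.generateFrom (range Iic) := by
    refine le_antisymm ?_ ?_
    · refine iSup_le fun i => ?_
      rw [← measurable_iff_comap_le]
      let _ : MeasurableSpace (ι → ℝ≥0∞) := MeasurableSpace.generateFrom (range Iic)
      refine measurable_of_Iic fun c => MeasurableSpace.measurableSet_generateFrom
        ⟨Function.update ⊤ i c, ?_⟩
      ext x
      simp only [mem_Iic, mem_preimage, Pi.le_def]
      refine ⟨fun hx => by simpa using hx i, fun hx j => ?_⟩
      by_cases hj : j = i
      · subst hj; simpa using hx
      · simp [hj]
    · refine MeasurableSpace.generateFrom_le ?_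
      rintro _ ⟨a, rfl⟩
      exact measurableSet_Iic
  refine ext_of_generate_finite _ hgen ?_ ?_ ?_
  · rintro _ ⟨a, rfl⟩ _ ⟨b, rfl⟩ -
    exact ⟨a ⊓ b, Iic_inter_Iic.symm⟩
  · rintro _ ⟨a, rfl⟩; exact h a
  · simpa using h ⊤

/-- **Kolmogorov's extension theorem** for compact metrizable state spaces. -/
theorem exists_isProjectiveLimit {ι E : Type*} [TopologicalSpace E] [CompactSpace E] [T2Space E]
    [SecondCountableTopology E] [MeasurableSpace E] [BorelSpace E]
    {P : ∀ J : Finset ι, Measure (J → E)} [∀ J, IsProbabilityMeasure (P J)]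
    (hP : IsProjectiveMeasureFamily (α := fun _ => E) P) :
    ∃ Q : Measure (ι → E), IsProjectiveLimit (α := fun _ => E) Q P := by
  have htend : ∀ ⦃s : ℕ → Set (ι → E)⦄, (∀ n, s n ∈ measurableCylinders (fun _ => E)) →
      Antitone s → (⋂ n, s n) = ∅ →
      Tendsto (fun n => projectiveFamilyContent hP (s n)) atTop (𝓝 0) := by
    intro s hs hanti hempty
    have hcyl n : ∃ J S, MeasurableSet S ∧ s n = cylinder (α := fun _ => E) J S :=
      (mem_measurableCylinders _).1 (hs n)
    choose J A hA hsA using hcyl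
    refine ENNReal.tendsto_nhds_zero.2 fun ε hε => ?_
    obtain ⟨δ, hδ, hδsum⟩ := ENNReal.exists_pos_sum_of_countable hε.ne' ℕ
    -- inside each cylinder choose a closed one of almost the same mass
    have hK n : ∃ K ⊆ A n, IsClosed K ∧ P (J n) (A n \ K) < δ n := by
      obtain ⟨K, hKA, -, hK, h⟩ := (hA n).exists_isCompact_isClosed_sdiff_lt
        (measure_ne_top (P (J n)) _) (ENNReal.coe_ne_zero.2 (hδ n).ne')
      exact ⟨K, hKA, hK, h⟩
    choose K hKA hKc hKδ using hK
    set C : ℕ → Set (ι → E) := fun n => cylinder (α := fun _ => E) (J n) (K n) with hC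
    have hCc n : IsClosed (C n) := (hKc n).cylinder _
    have hCs n : C n ⊆ s n := by
      rw [hsA]; exact fun x hx => hKA n hx
    have hCm n : C n ∈ measurableCylinders (fun _ => E) :=
      cylinder_mem_measurableCylinders _ _ (hKc n).measurableSet
    -- by compactness finitely many of the closed cylinders already have empty intersection
    have hCe : ⋂ n, C n = ∅ := subset_empty_iff.1 (hempty ▸ iInter_mono hCs)
    obtain ⟨t, ht⟩ := isCompact_univ.elim_finite_subfamily_closed C hCc (by simpa using hCe)
    rw [univ_inter] at ht
    obtain ⟨N, hN⟩ := t.bddAbove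
    refine eventually_atTop.2 ⟨N, fun n hn => ?_⟩
    have hsub : s n ⊆ ⋃ i ∈ t, s i \ C i := by
      intro x hx
      by_contra hcon
      simp only [mem_iUnion, Set.mem_sdiff, not_exists, not_and, not_not] at hcon
      have : x ∈ ⋂ i ∈ t, C i :=
        mem_iInter₂.2 fun i hi => hcon i hi (hanti ((hN hi).trans hn) hx)
      rw [ht] at this
      exact this
    have hd i : s i \ C i ∈ measurableCylinders (fun _ => E) :=
      sdiff_mem_measurableCylinders (hs i) (hCm i)
    calc projectiveFamilyContent hP (s n)
        ≤ projectiveFamilyContent hP (⋃ i ∈ t, s i \ C i) :=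
          projectiveFamilyContent_mono hP (hs n)
            (isSetRing_measurableCylinders.biUnion_mem t fun i _ => hd i) hsub
      _ ≤ ∑ i ∈ t, projectiveFamilyContent hP (s i \ C i) :=
          addContent_biUnion_le isSetRing_measurableCylinders fun i _ => hd i
      _ ≤ ∑ i ∈ t, (δ i : ℝ≥0∞) := by
          refine Finset.sum_le_sum fun i _ => ?_
          rw [hsA i, hC, sdiff_cylinder_same, projectiveFamilyContent_cylinder hP
            ((hA i).diff (hKc i).measurableSet)]
          exact (hKδ i).le
      _ ≤ ∑' i, (δ i : ℝ≥0∞) := ENNReal.sum_le_tsum t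
      _ ≤ ε := hδsum.le
  have hsub : (projectiveFamilyContent hP).IsSigmaSubadditive :=
    isSigmaSubadditive_of_addContent_iUnion_eq_tsum isSetRing_measurableCylinders
      fun f hf hfU hf' => addContent_iUnion_eq_sum_of_tendsto_zero isSetRing_measurableCylinders
        (projectiveFamilyContent hP) (fun s _ => projectiveFamilyContent_ne_top hP) htend hf hfU hf'
  refine ⟨(projectiveFamilyContent hP).measure isSetSemiring_measurableCylinders
    generateFrom_measurableCylinders.ge hsub, fun I => ?_⟩
  ext s hs
  rw [Measure.map_apply (Finset.measurable_restrict I) hs, AddContent.measure_eq]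
  · exact projectiveFamilyContent_cylinder hP hs
  · exact generateFrom_measurableCylinders.symm
  · exact cylinder_mem_measurableCylinders _ _ hs

/-! ### Extremal integrals of index one -/

lemma volume_Ioi_ofReal_lt (e : ℝ≥0∞) :
    volume.restrict (Ioi (0 : ℝ)) {u | ENNReal.ofReal u < e} = e := by
  rw [Measure.restrict_apply (measurableSet_lt ENNReal.measurable_ofReal measurable_const)]
  rcases eq_or_ne e ∞ with rfl | he
  · have : {u | ENNReal.ofReal u < ∞} ∩ Ioi (0 : ℝ) = Ioi 0 := by ext u; simp
    rw [this, Real.volume_Ioi]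
  · have : {u | ENNReal.ofReal u < e} ∩ Ioi (0 : ℝ) = Ioo 0 e.toReal := by
      ext u
      rw [mem_inter_iff, mem_Ioi, mem_Ioo, and_comm]
      exact and_congr_right fun hu => ENNReal.ofReal_lt_iff_lt_toReal hu.le he
    rw [this, Real.volume_Ioo, sub_zero, ENNReal.ofReal_toReal he]

/-- The conventions `0 / 0 = 0` and `x / ∞ = 0` make this hold also for `b = 0` and `b = ∞`. -/
lemma lt_div_ofReal_iff (x : ℝ≥0) (b : ℝ≥0∞) {u : ℝ} (hu : 0 < u) :
    b < x / ENNReal.ofReal u ↔ ENNReal.ofReal u < x / b := by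
  have hu' : ENNReal.ofReal u ≠ 0 := by simpa using hu
  rw [ENNReal.lt_div_iff_mul_lt (Or.inl hu') (Or.inl ENNReal.ofReal_ne_top)]
  rcases eq_or_ne b 0 with rfl | hb
  · rcases eq_or_ne x 0 with rfl | hx
    · simp
    · have h : (x : ℝ≥0∞) ≠ 0 := by simpa using hx
      simp [ENNReal.div_zero h, pos_iff_ne_zero, hx]
  · rcases eq_or_ne b ∞ with rfl | hbt
    · simp [ENNReal.top_mul hu']
    · rw [ENNReal.lt_div_iff_mul_lt (Or.inl hb) (Or.inl hbt), mul_comm]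

/-- Where an integrable function does not vanish, the measure is σ-finite. -/
lemma sigmaFinite_restrict_support {S : Type*} [MeasurableSpace S] {μ : Measure S} {h : S → ℝ≥0}
    (hm : Measurable h) (hi : ∫⁻ s, h s ∂μ ≠ ∞) : SigmaFinite (μ.restrict {s | h s ≠ 0}) := by
  refine ⟨⟨⟨fun n => {s | (1 : ℝ≥0∞) / (n + 1) ≤ h s} ∪ {s | h s = 0}, fun _ => trivial,
    fun n => ?_, ?_⟩⟩⟩
  · refine (measure_union_le _ _).trans_lt (ENNReal.add_lt_top.2 ⟨?_, ?_⟩)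
    · refine (Measure.restrict_apply_le _ _).trans_lt ?_
      refine (meas_ge_le_lintegral_div hm.coe_nnreal_ennreal.aemeasurable (by simp)
        (by simp)).trans_lt ?_
      exact ENNReal.div_lt_top hi (by simp)
    · rw [Measure.restrict_apply (show MeasurableSet {s | h s = 0} from
        (measurableSet_singleton (0 : ℝ≥0)).preimage hm)]
      have : {s | h s = 0} ∩ {s | h s ≠ 0} = ∅ := by ext; simp
      simp [this]
  · refine eq_univ_of_forall fun s => mem_iUnion.2 ?_
    rcases eq_or_ne (h s) 0 with h0 | h0
    · exact ⟨0, Or.inr h0⟩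
    · obtain ⟨n, hn⟩ := ENNReal.exists_inv_nat_lt (ENNReal.coe_ne_zero.2 h0)
      refine ⟨n, Or.inl ?_⟩
      rw [mem_ofPred_eq, one_div]
      exact (ENNReal.inv_le_inv.2 (by simp)).trans hn.le

/-- The law of finitely many extremal integrals of index `1`: the supremum of the points
`h(s) / u` of a Poisson process on pairs `(s, u)` with intensity `μ(ds) du`. -/
theorem exists_extremalIntegral_of_finite {ι S : Type*} [Finite ι] [MeasurableSpace S]
    (μ : Measure S) {h : ι → S → ℝ≥0} (hm : ∀ i, Measurable (h i))
    (hi : ∀ i, ∫⁻ s, h i s ∂μ ≠ ∞) :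
    ∃ Q : Measure (ι → ℝ≥0∞), IsProbabilityMeasure Q ∧
      ∀ b, Q (Iic b) = expNeg (∫⁻ s, ⨆ i, h i s / b i ∂μ) := by
  cases nonempty_fintype ι
  -- `μ` need not be σ-finite, but it is where the `h i` do not all vanish
  set U : Set S := {s | ∑ i, h i s ≠ 0} with hU
  have hUm : MeasurableSet U := by measurability
  have : SigmaFinite (μ.restrict U) := by
    refine sigmaFinite_restrict_support (by fun_prop) ?_
    simp only [ENNReal.ofNNReal_finsetSum]
    rw [lintegral_finsetSum _ fun i _ => (hm i).coe_nnreal_ennreal]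
    exact (ENNReal.sum_lt_top.2 fun i _ => (hi i).lt_top).ne
  set φ : ℝ × S → ι → ℝ≥0∞ := fun p i => h i p.2 / ENNReal.ofReal p.1 with hφ
  have hφm : Measurable φ := by
    refine measurable_pi_lambda _ fun i => ?_
    exact ((hm i).comp measurable_snd).coe_nnreal_ennreal.div
      (ENNReal.measurable_ofReal.comp measurable_fst)
  obtain ⟨Q, hQ, hQb⟩ := exists_poissonMax
    (((volume.restrict (Ioi (0 : ℝ))).prod (μ.restrict U)).map φ)
  refine ⟨Q, hQ, fun b => ?_⟩
  rw [hQb, Measure.map_apply hφm measurableSet_Iic.compl,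
    Measure.prod_apply_symm (hφm measurableSet_Iic.compl)]
  congr 1
  have hfib (s : S) : volume.restrict (Ioi (0 : ℝ)) ((fun u => (u, s)) ⁻¹' (φ ⁻¹' (Iic b)ᶜ))
      = ⨆ i, h i s / b i := by
    rw [← volume_Ioi_ofReal_lt (⨆ i, (h i s : ℝ≥0∞) / b i)]
    refine measure_congr ?_
    filter_upwards [ae_restrict_mem measurableSet_Ioi] with u hu
    refine propext ?_
    change ¬ (φ (u, s) ≤ b) ↔ ENNReal.ofReal u < ⨆ i, (h i s : ℝ≥0∞) / b i
    simp only [Pi.le_def, not_forall, not_le, lt_iSup_iff]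
    exact exists_congr fun i => lt_div_ofReal_iff _ _ hu
  simp only [hfib]
  rw [← lintegral_indicator hUm]
  refine lintegral_congr fun s => ?_
  by_cases hs : s ∈ U
  · rw [indicator_of_mem hs]
  · rw [indicator_of_notMem hs]
    have : ∀ i, h i s = 0 := by simpa [hU] using hs
    simp [this]

/-- The law on path space of the process of extremal integrals of index `1`. -/
theorem exists_extremalIntegral {T S : Type*} [MeasurableSpace S] (μ : Measure S)
    {h : T → S → ℝ≥0} (hm : ∀ t, Measurable (h t)) (hi : ∀ t, ∫⁻ s, h t s ∂μ ≠ ∞) :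
    ∃ Q : Measure (T → ℝ≥0∞), IsProbabilityMeasure Q ∧ ∀ (I : Finset T) (b : T → ℝ≥0∞),
      Q {x | ∀ i ∈ I, x i ≤ b i} = expNeg (∫⁻ s, ⨆ i ∈ I, h i s / b i ∂μ) := by
  classical
  choose P hPp hP using fun I : Finset T => exists_extremalIntegral_of_finite μ
    (h := fun i : I => h i) (fun i => hm i) (fun i => hi i)
  have hproj : IsProjectiveMeasureFamily (α := fun _ : T => ℝ≥0∞) P := by
    intro I J hJI
    have := hPp I
    refine ext_of_Iic_pi fun b => ?_
    rw [Measure.map_apply (Finset.measurable_restrict₂ (X := fun _ : T => ℝ≥0∞) hJI) measurableSet_Iic]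
    -- unconstrained coordinates are bounded by `∞`
    set b' : I → ℝ≥0∞ := fun i => if hi : (i : T) ∈ J then b ⟨i, hi⟩ else ∞ with hb'
    have : Finset.restrict₂ (π := fun _ : T => ℝ≥0∞) hJI ⁻¹' Iic b = Iic b' := by
      ext x
      simp only [mem_preimage, mem_Iic, Pi.le_def, hb']
      constructor
      · intro hx i
        split_ifs with hi
        · exact hx ⟨i, hi⟩
        · exact le_top
      · intro hx j
        have := hx ⟨j, hJI j.2⟩
        simpa using this
    rw [this, hP, hP]
    congr 1
    refine lintegral_congr fun s => le_antisymm (iSup_le fun j => ?_) (iSup_le fun i => ?_)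
    · refine le_iSup_of_le (⟨j, hJI j.2⟩ : I) ?_
      simp [hb']
    · by_cases hi : (i : T) ∈ J
      · refine le_iSup_of_le (⟨i, hi⟩ : J) ?_
        simp [hb', hi]
      · simp [hb', hi]
  obtain ⟨Q, hQ⟩ := exists_isProjectiveLimit hproj
  refine ⟨Q, hQ.isProbabilityMeasure, fun I b => ?_⟩
  have h1 : {x : T → ℝ≥0∞ | ∀ i ∈ I, x i ≤ b i} = I.restrict ⁻¹' Iic fun i : I => b i := by
    ext x; simp [Pi.le_def]
  rw [h1, ← Measure.map_apply (Finset.measurable_restrict I) measurableSet_Iic, hQ I, hP]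
  simp only [iSup_subtype]

/-! ### The Lévy measure and the signs of the spectral functions -/

/-- The integrand `(1 - cos (u x)) u^{-1-α}` whose integral over `u > 0` is a multiple of
`|x|^α`. -/
noncomputable def stableKernel (α x u : ℝ) : ℝ := (1 - Real.cos (u * x)) * u ^ (-1 - α)

lemma stableKernel_nonneg {α x u : ℝ} (hu : 0 < u) : 0 ≤ stableKernel α x u :=
  mul_nonneg (sub_nonneg.2 (Real.cos_le_one _)) (Real.rpow_nonneg hu.le _)

lemma measurable_stableKernel_prod (α : ℝ) {S : Type*} [MeasurableSpace S] {f : S → ℝ}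
    (hf : Measurable f) : Measurable fun p : S × ℝ => stableKernel α (f p.1) p.2 := by
  unfold stableKernel
  fun_prop

lemma integrableOn_stableKernel_one {α : ℝ} (hα0 : 0 < α) (hα2 : α < 2) :
    IntegrableOn (stableKernel α 1) (Ioi 0) := by
  have hm : Measurable (stableKernel α 1) := by unfold stableKernel; fun_prop
  rw [← Ioc_union_Ioi_eq_Ioi zero_le_one]
  refine IntegrableOn.union ?_ ?_
  · have h : IntegrableOn (fun u : ℝ => u ^ (1 - α)) (Ioc 0 1) :=
      (intervalIntegrable_iff_integrableOn_Ioc_of_le zero_le_one).1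
        (intervalIntegral.intervalIntegrable_rpow' (by linarith))
    refine Integrable.mono' h hm.aestronglyMeasurable ?_
    filter_upwards [ae_restrict_mem measurableSet_Ioc] with u hu
    rw [Real.norm_of_nonneg (stableKernel_nonneg hu.1), stableKernel, mul_one,
      show 1 - α = 2 + (-1 - α) by ring, Real.rpow_add hu.1]
    refine mul_le_mul_of_nonneg_right ?_ (Real.rpow_nonneg hu.1.le _)
    have := Real.one_sub_sq_div_two_le_cos (x := u)
    rw [Real.rpow_two]
    nlinarith [sq_nonneg u]
  · have h : IntegrableOn (fun u : ℝ => 2 * u ^ (-1 - α)) (Ioi 1) :=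
      (integrableOn_Ioi_rpow_of_lt (by linarith) zero_lt_one).const_mul 2
    refine Integrable.mono' h hm.aestronglyMeasurable ?_
    filter_upwards [ae_restrict_mem measurableSet_Ioi] with u hu
    have hu0 : (0 : ℝ) < u := zero_lt_one.trans hu
    rw [Real.norm_of_nonneg (stableKernel_nonneg hu0), stableKernel]
    refine mul_le_mul_of_nonneg_right ?_ (Real.rpow_nonneg hu0.le _)
    linarith [Real.neg_one_le_cos (u * 1)]

/-- The constant `∫₀^∞ (1 - cos u) u^{-1-α} du`. -/
noncomputable def stableConst (α : ℝ) : ℝ := ∫ u in Ioi 0, stableKernel α 1 u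

lemma stableConst_pos {α : ℝ} (hα0 : 0 < α) (hα2 : α < 2) : 0 < stableConst α := by
  rw [stableConst, setIntegral_pos_iff_support_of_nonneg_ae _
    (integrableOn_stableKernel_one hα0 hα2)]
  · have h1 : Ioo (0 : ℝ) 1 ⊆ Function.support (stableKernel α 1) ∩ Ioi 0 := by
      intro u hu
      refine ⟨?_, hu.1⟩
      rw [Function.mem_support, stableKernel, mul_one]
      refine mul_ne_zero ?_ (Real.rpow_pos_of_pos hu.1 _).ne'
      intro h
      have := (Real.cos_eq_one_iff_of_lt_of_lt (x := u) (by linarith [Real.pi_gt_three, hu.1])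
        (by linarith [Real.pi_gt_three, hu.2])).1 (by linarith)
      exact hu.1.ne' this
    exact lt_of_lt_of_le (by simp) (measure_mono h1)
  · filter_upwards [ae_restrict_mem measurableSet_Ioi] with u hu using stableKernel_nonneg hu

lemma stableKernel_eq_scaled {α x u : ℝ} (hx : x ≠ 0) (hu : 0 < u) :
    stableKernel α x u = |x| ^ (1 + α) * stableKernel α 1 (u * |x|) := by
  have hx' : 0 < |x| := abs_pos.2 hx
  have hc : Real.cos (u * x) = Real.cos (u * |x|) := by
    rw [← Real.cos_abs, abs_mul, abs_of_pos hu]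
  rw [stableKernel, stableKernel, mul_one, Real.mul_rpow hu.le hx'.le, hc]
  have : |x| ^ (1 + α) * |x| ^ (-1 - α) = 1 := by
    rw [← Real.rpow_add hx']; simp
  linear_combination (-(1 - Real.cos (u * |x|)) * u ^ (-1 - α)) * this

lemma integrableOn_stableKernel {α : ℝ} (hα0 : 0 < α) (hα2 : α < 2) (x : ℝ) :
    IntegrableOn (stableKernel α x) (Ioi 0) := by
  rcases eq_or_ne x 0 with rfl | hx
  · have : stableKernel α 0 = fun _ => 0 := by ext u; simp [stableKernel]
    rw [this]; exact integrableOn_zero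
  · have h := (integrableOn_Ioi_comp_mul_right_iff (stableKernel α 1) 0 (abs_pos.2 hx)).2
      (by simpa using integrableOn_stableKernel_one hα0 hα2)
    exact IntegrableOn.congr_fun (h.const_mul (|x| ^ (1 + α)))
      (fun u hu => (stableKernel_eq_scaled hx hu).symm) measurableSet_Ioi

lemma integral_stableKernel {α : ℝ} (hα0 : 0 < α) (x : ℝ) :
    ∫ u in Ioi 0, stableKernel α x u = stableConst α * |x| ^ α := by
  rcases eq_or_ne x 0 with rfl | hx
  · simp [stableKernel, Real.zero_rpow hα0.ne']
  · have hx' : 0 < |x| := abs_pos.2 hx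
    rw [setIntegral_congr_fun measurableSet_Ioi fun u hu => stableKernel_eq_scaled hx hu,
      integral_const_mul, integral_comp_mul_right_Ioi (stableKernel α 1) 0 hx', zero_mul,
      smul_eq_mul, stableConst, Real.rpow_add hx', Real.rpow_one]
    field_simp

/-- Against the weight `stableKernel α p`, the function `u ↦ cos (u x)` integrates to a
multiple of a second difference of `|·|^α` at `x`. -/
lemma integral_stableKernel_mul_cos {α : ℝ} (hα0 : 0 < α) (hα2 : α < 2) (p x : ℝ) :
    ∫ u in Ioi 0, stableKernel α p u * Real.cos (u * x) =
      stableConst α / 2 * (|x + p| ^ α + |x - p| ^ α - 2 * |x| ^ α) := by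
  have h (u : ℝ) : stableKernel α p u * Real.cos (u * x) =
      2⁻¹ * (stableKernel α (x + p) u + stableKernel α (x - p) u - 2 * stableKernel α x u) := by
    simp only [stableKernel, mul_add, mul_sub, Real.cos_add, Real.cos_sub]
    ring
  have hi := integrableOn_stableKernel hα0 hα2
  have hadd : IntegrableOn (fun u => stableKernel α (x + p) u + stableKernel α (x - p) u) (Ioi 0) :=
    (hi _).add (hi _)
  simp only [h]
  rw [integral_const_mul, integral_sub hadd ((hi _).const_mul 2),
    integral_add (hi _) (hi _), integral_const_mul, integral_stableKernel hα0,
    integral_stableKernel hα0, integral_stableKernel hα0]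
  ring

section LevyMeasure

variable {S : Type*} [MeasurableSpace S]

/-- The Lévy measure of the stable vector with spectral functions `(f₁, f₂)`, weighted by
`1 - cos z₁` to make it finite: the image under `(s, u) ↦ (u f₁(s), u f₂(s))` of
`(1 - cos (u f₁(s))) u^{-1-α} μ(ds) du` on `u > 0`. The weight vanishes where `f₁ = 0`; leaving
that set out makes the restriction of `μ` σ-finite, so that the product measure is meaningful. -/
noncomputable def weightedLevy (α : ℝ) (μ : Measure S) (f₁ f₂ : S → ℝ) : Measure (ℝ × ℝ) :=
  (((μ.restrict {s | f₁ s ≠ 0}).prod (volume.restrict (Ioi (0 : ℝ)))).withDensity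
    fun p => ENNReal.ofReal (stableKernel α (f₁ p.1) p.2)).map
      fun p => (p.2 * f₁ p.1, p.2 * f₂ p.1)

variable {α : ℝ} {μ : Measure S} {f₁ f₂ : S → ℝ}

lemma integrable_abs_rpow (hα0 : 0 < α) {f : S → ℝ} (hf : MemLp f (ENNReal.ofReal α) μ) :
    Integrable (fun s => |f s| ^ α) μ := by
  have := hf.integrable_norm_rpow (by simpa using hα0) ENNReal.ofReal_ne_top
  simpa [ENNReal.toReal_ofReal hα0.le] using this

lemma lintegral_nnnorm_rpow_ne_top (hα0 : 0 < α) {f : S → ℝ} (hf : MemLp f (ENNReal.ofReal α) μ) :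
    ∫⁻ s, ((‖f s‖₊ ^ α : ℝ≥0) : ℝ≥0∞) ∂μ ≠ ∞ := by
  have := (integrable_abs_rpow hα0 hf).2
  rw [hasFiniteIntegral_iff_enorm] at this
  refine (lt_of_eq_of_lt (lintegral_congr fun s => ?_) this).ne
  rw [Real.enorm_of_nonneg (Real.rpow_nonneg (abs_nonneg _) _),
    ← ENNReal.ofReal_rpow_of_nonneg (abs_nonneg _) hα0.le, ENNReal.coe_rpow_of_nonneg _ hα0.le,
    ← Real.enorm_eq_ofReal_abs]
  rfl

lemma sigmaFinite_restrict_ne_zero (hα0 : 0 < α) (hm : Measurable f₁)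
    (hf : MemLp f₁ (ENNReal.ofReal α) μ) : SigmaFinite (μ.restrict {s | f₁ s ≠ 0}) := by
  have := sigmaFinite_restrict_support (h := fun s => ‖f₁ s‖₊ ^ α) (by fun_prop)
    (lintegral_nnnorm_rpow_ne_top hα0 hf)
  simpa [NNReal.rpow_eq_zero_iff, hα0.ne'] using this

lemma integrable_stableKernel_prod (hα0 : 0 < α) (hα2 : α < 2) (hm : Measurable f₁)
    (hf : MemLp f₁ (ENNReal.ofReal α) μ) :
    Integrable (fun p : S × ℝ => stableKernel α (f₁ p.1) p.2)
      ((μ.restrict {s | f₁ s ≠ 0}).prod (volume.restrict (Ioi (0 : ℝ)))) := by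
  have := sigmaFinite_restrict_ne_zero hα0 hm hf
  rw [integrable_prod_iff (measurable_stableKernel_prod α hm).aestronglyMeasurable]
  refine ⟨Eventually.of_forall fun s => integrableOn_stableKernel hα0 hα2 (f₁ s), ?_⟩
  have h (s : S) : ∫ u in Ioi 0, ‖stableKernel α (f₁ s) u‖ = stableConst α * |f₁ s| ^ α := by
    rw [← integral_stableKernel hα0]
    exact setIntegral_congr_fun measurableSet_Ioi
      fun u hu => Real.norm_of_nonneg (stableKernel_nonneg hu)
  simp only [h]
  exact ((integrable_abs_rpow hα0 hf).const_mul _).restrict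

lemma isFiniteMeasure_weightedLevy (hα0 : 0 < α) (hα2 : α < 2) (hm : Measurable f₁)
    (hf : MemLp f₁ (ENNReal.ofReal α) μ) : IsFiniteMeasure (weightedLevy α μ f₁ f₂) := by
  have := isFiniteMeasure_withDensity_ofReal (integrable_stableKernel_prod hα0 hα2 hm hf).2
  exact Measure.isFiniteMeasure_map _ _

/-- The real part of the characteristic function of `weightedLevy` is a multiple of a second difference
of the function `(a, b) ↦ ∫ |a f₁ + b f₂|^α dμ`. -/
lemma integral_cos_weightedLevy (hα0 : 0 < α) (hα2 : α < 2) (hm₁ : Measurable f₁)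
    (hm₂ : Measurable f₂) (hf₁ : MemLp f₁ (ENNReal.ofReal α) μ)
    (hf₂ : MemLp f₂ (ENNReal.ofReal α) μ) (a b : ℝ) :
    ∫ z, Real.cos (a * z.1 + b * z.2) ∂weightedLevy α μ f₁ f₂ =
      stableConst α / 2 * ((∫ s, |(a + 1) * f₁ s + b * f₂ s| ^ α ∂μ) +
        (∫ s, |(a - 1) * f₁ s + b * f₂ s| ^ α ∂μ) - 2 * ∫ s, |a * f₁ s + b * f₂ s| ^ α ∂μ) := by
  have := sigmaFinite_restrict_ne_zero hα0 hm₁ hf₁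
  have hk := measurable_stableKernel_prod α hm₁
  have hint (a b : ℝ) : Integrable (fun s => |a * f₁ s + b * f₂ s| ^ α) μ :=
    integrable_abs_rpow hα0 ((hf₁.const_mul a).add (hf₂.const_mul b))
  rw [weightedLevy, integral_map (by fun_prop) (by fun_prop),
    integral_withDensity_eq_integral_toReal_smul hk.ennreal_ofReal (by simp)]
  have h1 : ∫ p : S × ℝ, (ENNReal.ofReal (stableKernel α (f₁ p.1) p.2)).toReal •
      Real.cos (a * (p.2 * f₁ p.1) + b * (p.2 * f₂ p.1))
        ∂(μ.restrict {s | f₁ s ≠ 0}).prod (volume.restrict (Ioi (0 : ℝ))) =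
      ∫ p : S × ℝ, stableKernel α (f₁ p.1) p.2 * Real.cos (p.2 * (a * f₁ p.1 + b * f₂ p.1))
        ∂(μ.restrict {s | f₁ s ≠ 0}).prod (volume.restrict (Ioi (0 : ℝ))) := by
    have hpos : ∀ᵐ p ∂(μ.restrict {s | f₁ s ≠ 0}).prod (volume.restrict (Ioi (0 : ℝ))),
        p.2 ∈ Ioi (0 : ℝ) :=
      Measure.quasiMeasurePreserving_snd.ae (ae_restrict_mem measurableSet_Ioi)
    refine integral_congr_ae ?_
    filter_upwards [hpos] with p hp
    rw [ENNReal.toReal_ofReal (stableKernel_nonneg hp), smul_eq_mul]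
    ring_nf
  rw [h1, integral_prod]
  · simp only [integral_stableKernel_mul_cos hα0 hα2]
    rw [setIntegral_eq_integral_of_forall_compl_eq_zero]
    · rw [integral_const_mul]
      have e1 (s : S) : a * f₁ s + b * f₂ s + f₁ s = (a + 1) * f₁ s + b * f₂ s := by ring
      have e2 (s : S) : a * f₁ s + b * f₂ s - f₁ s = (a - 1) * f₁ s + b * f₂ s := by ring
      simp only [e1, e2]
      have hadd : Integrable (fun s => |(a + 1) * f₁ s + b * f₂ s| ^ α +
          |(a - 1) * f₁ s + b * f₂ s| ^ α) μ := (hint _ _).add (hint _ _)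
      rw [integral_sub hadd ((hint _ _).const_mul 2),
        integral_add (hint _ _) (hint _ _), integral_const_mul]
    · intro s hs
      have : f₁ s = 0 := by simpa using hs
      simp only [this, mul_zero, zero_add, add_zero, sub_zero]
      ring
  · refine (integrable_stableKernel_prod hα0 hα2 hm₁ hf₁).mul_bdd (c := 1) (by fun_prop) ?_
    exact Eventually.of_forall fun p => by simpa using Real.abs_cos_le_one _

/-- The weighted Lévy measure charges the open second and fourth quadrants exactly when the two
spectral functions have opposite signs on a set of positive measure. -/
lemma weightedLevy_quadrants_eq_zero_iff (hα0 : 0 < α) (hα2 : α < 2) (hm₁ : Measurable f₁)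
    (hm₂ : Measurable f₂) (hf₁ : MemLp f₁ (ENNReal.ofReal α) μ) :
    weightedLevy α μ f₁ f₂ {z | z.1 * z.2 < 0} = 0 ↔ ∀ᵐ s ∂μ, 0 ≤ f₁ s * f₂ s := by
  have := sigmaFinite_restrict_ne_zero hα0 hm₁ hf₁
  have hk := measurable_stableKernel_prod α hm₁
  have hA : MeasurableSet {z : ℝ × ℝ | z.1 * z.2 < 0} :=
    measurableSet_lt (by fun_prop) measurable_const
  have hms : MeasurableSet {s | f₁ s ≠ 0} := (measurableSet_singleton (0 : ℝ)).compl.preimage hm₁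
  rw [weightedLevy, Measure.map_apply (by fun_prop) hA, measure_eq_zero_iff_ae_notMem,
    ae_withDensity_iff hk.ennreal_ofReal]
  constructor
  · intro h
    have h2 := (ae_restrict_iff' hms).1 (Measure.ae_ae_of_ae_prod h)
    filter_upwards [h2] with s hs
    by_contra hneg
    rw [not_le] at hneg
    have hne : f₁ s ≠ 0 := fun h0 => by simp [h0] at hneg
    have hz : ∀ᵐ u ∂volume.restrict (Ioi (0 : ℝ)), stableKernel α (f₁ s) u = 0 := by
      filter_upwards [hs hne, ae_restrict_mem measurableSet_Ioi] with u hu hu0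
      by_contra hku
      refine hu ?_ ?_
      · simpa using lt_of_le_of_ne (stableKernel_nonneg hu0) (Ne.symm hku)
      · change u * f₁ s * (u * f₂ s) < 0
        have : u * f₁ s * (u * f₂ s) = u * u * (f₁ s * f₂ s) := by ring
        rw [this]
        exact mul_neg_of_pos_of_neg (mul_pos hu0 hu0) hneg
    have h0 := integral_stableKernel hα0 (f₁ s)
    rw [integral_eq_zero_of_ae hz] at h0
    exact (mul_pos (stableConst_pos hα0 hα2) (Real.rpow_pos_of_pos (abs_pos.2 hne) α)).ne h0
  · intro h
    have h2 : ∀ᵐ p ∂(μ.restrict {s | f₁ s ≠ 0}).prod (volume.restrict (Ioi (0 : ℝ))),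
        0 ≤ f₁ p.1 * f₂ p.1 :=
      Measure.quasiMeasurePreserving_fst.ae (ae_restrict_of_ae h)
    filter_upwards [h2] with p hp _
    change ¬ (p.2 * f₁ p.1 * (p.2 * f₂ p.1) < 0)
    have : p.2 * f₁ p.1 * (p.2 * f₂ p.1) = p.2 * p.2 * (f₁ p.1 * f₂ p.1) := by ring
    rw [not_lt, this]
    exact mul_nonneg (mul_self_nonneg _) hp

end LevyMeasure

/-- The symmetrization of a finite measure on the plane is determined by the integrals of
`cos (a z₁ + b z₂)`: they are half its characteristic function. -/
lemma add_map_neg_eq_of_integral_cos {M N : Measure (ℝ × ℝ)} [IsFiniteMeasure M]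
    [IsFiniteMeasure N] (h : ∀ a b : ℝ, ∫ z, Real.cos (a * z.1 + b * z.2) ∂M =
      ∫ z, Real.cos (a * z.1 + b * z.2) ∂N) :
    M + M.map Neg.neg = N + N.map Neg.neg := by
  have key (M : Measure (ℝ × ℝ)) [IsFiniteMeasure M] (L : StrongDual ℝ (ℝ × ℝ)) :
      charFunDual (M + M.map Neg.neg) L =
        2 * ((∫ z, Real.cos (L (1, 0) * z.1 + L (0, 1) * z.2) ∂M : ℝ) : ℂ) := by
    have hL (z : ℝ × ℝ) : L z = L (1, 0) * z.1 + L (0, 1) * z.2 := by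
      have : z = z.1 • ((1, 0) : ℝ × ℝ) + z.2 • ((0, 1) : ℝ × ℝ) := by ext <;> simp
      conv_lhs => rw [this]
      rw [map_add, map_smul, map_smul, smul_eq_mul, smul_eq_mul]; ring
    have hi (ν : Measure (ℝ × ℝ)) [IsFiniteMeasure ν] (g : ℝ × ℝ → ℝ) (hg : Continuous g) :
        Integrable (fun z => Complex.exp (g z * Complex.I)) ν := by
      refine Integrable.of_bound (by fun_prop) 1 (Eventually.of_forall fun z => ?_)
      rw [Complex.norm_exp_ofReal_mul_I]
    have hcont : Continuous fun z => -L z := by fun_prop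
    have hmap : IsFiniteMeasure (M.map (Neg.neg : ℝ × ℝ → ℝ × ℝ)) := Measure.isFiniteMeasure_map _ _
    rw [charFunDual_apply, integral_add_measure (hi _ _ L.continuous) (hi _ _ L.continuous),
      integral_map (by fun_prop) (by fun_prop)]
    simp only [map_neg]
    rw [← integral_add (hi _ _ L.continuous) (hi _ _ hcont), ← integral_complex_ofReal,
      ← integral_const_mul]
    refine integral_congr_ae (Eventually.of_forall fun z => ?_)
    simp only
    rw [← hL, Complex.ofReal_cos, Complex.cos]
    push_cast
    ring
  have : IsFiniteMeasure (M.map (Neg.neg : ℝ × ℝ → ℝ × ℝ)) := Measure.isFiniteMeasure_map _ _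
  have : IsFiniteMeasure (N.map (Neg.neg : ℝ × ℝ → ℝ × ℝ)) := Measure.isFiniteMeasure_map _ _
  refine Measure.ext_of_charFunDual (funext fun L => ?_)
  rw [key, key, h]

/-- Two pairs of functions with the same `L^α` norms of linear combinations, `0 < α < 2`: if the
functions of one pair have equal signs, so do those of the other. -/
theorem ae_mul_nonneg_of_integral_eq {S S' : Type*} [MeasurableSpace S] [MeasurableSpace S']
    {α : ℝ} (hα0 : 0 < α) (hα2 : α < 2) {μ : Measure S} {μ' : Measure S'} {f₁ f₂ : S → ℝ}
    {g₁ g₂ : S' → ℝ} (hf₁ : MemLp f₁ (ENNReal.ofReal α) μ) (hf₂ : MemLp f₂ (ENNReal.ofReal α) μ)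
    (hg₁ : MemLp g₁ (ENNReal.ofReal α) μ') (hg₂ : MemLp g₂ (ENNReal.ofReal α) μ')
    (h : ∀ a b : ℝ, ∫ s, |a * f₁ s + b * f₂ s| ^ α ∂μ = ∫ s, |a * g₁ s + b * g₂ s| ^ α ∂μ')
    (hg : ∀ᵐ s ∂μ', 0 ≤ g₁ s * g₂ s) : ∀ᵐ s ∂μ, 0 ≤ f₁ s * f₂ s := by
  -- pass to measurable versions
  wlog hm : Measurable f₁ ∧ Measurable f₂ ∧ Measurable g₁ ∧ Measurable g₂ generalizing f₁ f₂ g₁ g₂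
  · have e1 := hf₁.1.ae_eq_mk
    have e2 := hf₂.1.ae_eq_mk
    have e3 := hg₁.1.ae_eq_mk
    have e4 := hg₂.1.ae_eq_mk
    have := this (hf₁.ae_eq e1) (hf₂.ae_eq e2) (hg₁.ae_eq e3) (hg₂.ae_eq e4) (fun a b => ?_) ?_
      ⟨hf₁.1.stronglyMeasurable_mk.measurable, hf₂.1.stronglyMeasurable_mk.measurable,
        hg₁.1.stronglyMeasurable_mk.measurable, hg₂.1.stronglyMeasurable_mk.measurable⟩
    · filter_upwards [this, e1, e2] with s hs h1 h2
      rwa [h1, h2]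
    · convert h a b using 1
      · refine integral_congr_ae ?_
        filter_upwards [e1, e2] with s h1 h2
        rw [h1, h2]
      · refine integral_congr_ae ?_
        filter_upwards [e3, e4] with s h1 h2
        rw [h1, h2]
    · filter_upwards [hg, e3, e4] with s hs h1 h2
      rwa [← h1, ← h2]
  obtain ⟨m1, m2, m3, m4⟩ := hm
  rw [← weightedLevy_quadrants_eq_zero_iff hα0 hα2 m1 m2 hf₁]
  rw [← weightedLevy_quadrants_eq_zero_iff hα0 hα2 m3 m4 hg₁] at hg
  have := isFiniteMeasure_weightedLevy (f₂ := f₂) hα0 hα2 m1 hf₁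
  have := isFiniteMeasure_weightedLevy (f₂ := g₂) hα0 hα2 m3 hg₁
  have heq := add_map_neg_eq_of_integral_cos (M := weightedLevy α μ f₁ f₂)
    (N := weightedLevy α μ' g₁ g₂) fun a b => by
      rw [integral_cos_weightedLevy hα0 hα2 m1 m2 hf₁ hf₂,
        integral_cos_weightedLevy hα0 hα2 m3 m4 hg₁ hg₂, h, h, h]
  have hA : MeasurableSet {z : ℝ × ℝ | z.1 * z.2 < 0} :=
    measurableSet_lt (by fun_prop) measurable_const
  have hneg : (Neg.neg : ℝ × ℝ → ℝ × ℝ) ⁻¹' {z | z.1 * z.2 < 0} = {z | z.1 * z.2 < 0} := by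
    ext z; simp
  have h0 : (weightedLevy α μ' g₁ g₂ + (weightedLevy α μ' g₁ g₂).map Neg.neg)
      {z | z.1 * z.2 < 0} = 0 := by
    rw [Measure.add_apply, Measure.map_apply measurable_neg hA, hneg, hg, add_zero]
  rw [← heq, Measure.add_apply] at h0
  exact (add_eq_zero.1 h0).1

/-! ### Linear combinations of functions of equal signs -/

lemma Real.iSup_le_iff_of_finite {ι : Type*} [Finite ι] {x : ι → ℝ} {y : ℝ} (hy : 0 ≤ y) :
    ⨆ j, x j ≤ y ↔ ∀ j, x j ≤ y :=
  ⟨fun h j => (le_ciSup (finite_range x).bddAbove j).trans h, fun h => Real.iSup_le h hy⟩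

/-- Numbers of equal signs may be replaced by their absolute values in the modulus of a linear
combination. -/
lemma abs_sum_mul_abs {ι : Type*} [Fintype ι] {x : ι → ℝ} (h : ∀ i j, 0 ≤ x i * x j) (a : ι → ℝ) :
    |(∑ j, a j * |x j|)| = |∑ j, a j * x j| := by
  by_cases hpos : ∃ i, 0 < x i
  · obtain ⟨i, hi⟩ := hpos
    have hx j : |x j| = x j := abs_of_nonneg (nonneg_of_mul_nonneg_right (h i j) hi)
    simp only [hx]
  · push Not at hpos
    have hx j : |x j| = -x j := abs_of_nonpos (hpos j)
    simp only [hx, mul_neg, Finset.sum_neg_distrib, abs_neg]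

lemma integral_eq_of_eLpNorm_eq {S S' : Type*} [MeasurableSpace S] [MeasurableSpace S'] {α : ℝ}
    (hα0 : 0 < α) {μ : Measure S} {μ' : Measure S'} {f : S → ℝ} {g : S' → ℝ}
    (hf : MemLp f (ENNReal.ofReal α) μ) (hg : MemLp g (ENNReal.ofReal α) μ')
    (h : eLpNorm f (ENNReal.ofReal α) μ = eLpNorm g (ENNReal.ofReal α) μ') :
    ∫ s, |f s| ^ α ∂μ = ∫ s, |g s| ^ α ∂μ' := by
  have h0 : ENNReal.ofReal α ≠ 0 := by simpa using hα0
  rw [hf.eLpNorm_eq_integral_rpow_norm h0 ENNReal.ofReal_ne_top,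
    hg.eLpNorm_eq_integral_rpow_norm h0 ENNReal.ofReal_ne_top, ENNReal.toReal_ofReal hα0.le] at h
  have hnf : 0 ≤ ∫ s, ‖f s‖ ^ α ∂μ := integral_nonneg fun s => by positivity
  have hng : 0 ≤ ∫ s, ‖g s‖ ^ α ∂μ' := integral_nonneg fun s => by positivity
  rw [ENNReal.ofReal_eq_ofReal_iff (Real.rpow_nonneg hnf _) (Real.rpow_nonneg hng _)] at h
  exact Real.rpow_left_injOn (inv_ne_zero hα0.ne') hnf hng h

/-- Absolute values of functions of equal signs have the same norms of linear combinations. -/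
lemma sameLinearNorms_abs {S : Type*} [MeasurableSpace S] {n : ℕ} {α : ℝ} {μ : Measure S}
    {f : Fin n → S → ℝ} (h : ∀ i j, ∀ᵐ s ∂μ, 0 ≤ f i s * f j s) :
    SameLinearNorms α μ f μ (fun j s => |f j s|) := by
  intro a
  refine eLpNorm_congr_norm_ae ?_
  filter_upwards [ae_all_iff.2 fun i => ae_all_iff.2 (h i)] with s hs
  exact (abs_sum_mul_abs hs a).symm

lemma isNonnegLpFamily_abs {ι S : Type*} [MeasurableSpace S] {α : ℝ} {μ : Measure S}
    {f : ι → S → ℝ} (hf : ∀ j, MemLp (f j) (ENNReal.ofReal α) μ) :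
    IsNonnegLpFamily α μ (fun j s => |f j s|) :=
  fun j => ⟨(hf j).norm, Eventually.of_forall fun _ => abs_nonneg _⟩

/-- Equality of the norms of all linear combinations transfers the equality of signs from a
nonnegative family. -/
lemma ae_mul_nonneg_of_sameLinearNorms {S S' : Type*} [MeasurableSpace S] [MeasurableSpace S']
    {n : ℕ} {α : ℝ} (hα0 : 0 < α) (hα2 : α < 2) {μ : Measure S} {μ' : Measure S'}
    {f : Fin n → S → ℝ} {g : Fin n → S' → ℝ} (hf : ∀ j, MemLp (f j) (ENNReal.ofReal α) μ)
    (hg : IsNonnegLpFamily α μ' g) (h : SameLinearNorms α μ f μ' g) (i j : Fin n) :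
    ∀ᵐ s ∂μ, 0 ≤ f i s * f j s := by
  refine ae_mul_nonneg_of_integral_eq hα0 hα2 (hf i) (hf j) (hg i).1 (hg j).1 (fun a b => ?_) ?_
  · refine integral_eq_of_eLpNorm_eq hα0 (((hf i).const_mul a).add ((hf j).const_mul b))
      (((hg i).1.const_mul a).add ((hg j).1.const_mul b)) ?_
    have hsum (x : Fin n → ℝ) : ∑ k, (Pi.single i a + Pi.single j b : Fin n → ℝ) k * x k =
        a * x i + b * x j := by
      simp [add_mul, Finset.sum_add_distrib, Pi.single_apply]
    have := h (Pi.single i a + Pi.single j b)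
    simp only [hsum] at this
    exact this
  · filter_upwards [(hg i).2, (hg j).2] with s h1 h2 using mul_nonneg h1 h2

/-- A copy of the measure `μ` in a larger universe. -/
noncomputable def uliftMeasure {S : Type u} [MeasurableSpace S] (μ : Measure S) :
    Measure (ULift.{w} S) :=
  μ.map MeasurableEquiv.ulift.symm

lemma measurePreserving_uliftDown {S : Type u} [MeasurableSpace S] (μ : Measure S) :
    MeasurePreserving (ULift.down : ULift.{w} S → S) (uliftMeasure μ) μ := by
  have h : MeasurePreserving (MeasurableEquiv.ulift.symm : S ≃ᵐ ULift.{w} S) μ (uliftMeasure μ) :=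
    ⟨MeasurableEquiv.measurable _, rfl⟩
  exact h.symm

/-! ### Extremal integrals of index `α` -/

/-- The scale `σ` of `max_j aⱼ Y_{tⱼ}` is given by `σ^α = ∫ (max_j aⱼ g_{tⱼ})^α dμ`. -/
theorem HasExtremalRepresentation.isFrechetProcess {T Ω S : Type*} [MeasurableSpace Ω]
    [MeasurableSpace S] {α : ℝ} (hα0 : 0 < α) {Y : T → Ω → ℝ} {P : Measure Ω}
    {g : T → S → ℝ} {μ : Measure S} (h : HasExtremalRepresentation α Y P g μ) :
    IsFrechetProcess α Y P := by
  obtain ⟨hY, hg, hcdf⟩ := h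
  intro n t a ha
  refine ⟨AEMeasurable.iSup fun j => (hY (t j)).1.const_mul (a j), ?_, ?_⟩
  · filter_upwards [ae_all_iff.2 fun j => (hY (t j)).2] with ω hω
    exact Real.iSup_nonneg fun j => mul_nonneg (ha j) (hω j)
  have hnn : ∀ᵐ s ∂μ, 0 ≤ ⨆ j, a j * g (t j) s := by
    filter_upwards [ae_all_iff.2 fun j => (hg (t j)).2] with s hs
    exact Real.iSup_nonneg fun j => mul_nonneg (ha j) (hs j)
  have hint : 0 ≤ ∫ s, (⨆ j, a j * g (t j) s) ^ α ∂μ :=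
    integral_nonneg_of_ae (hnn.mono fun s hs => Real.rpow_nonneg hs _)
  refine ⟨(∫ s, (⨆ j, a j * g (t j) s) ^ α ∂μ) ^ α⁻¹, Real.rpow_nonneg hint _, fun y hy => ?_⟩
  rw [Real.rpow_inv_rpow hint hα0.ne']
  -- only the indices with a positive coefficient impose a condition
  let e := (Fintype.equivFin {j // 0 < a j}).symm
  have hset : {ω | ⨆ j, a j * Y (t j) ω ≤ y} = {ω | ∀ k, Y (t (e k)) ω ≤ y / a (e k)} := by
    ext ω
    rw [mem_ofPred_eq, mem_ofPred_eq, Real.iSup_le_iff_of_finite hy.le]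
    constructor
    · intro h k
      rw [le_div_iff₀' (e k).2]
      exact h _
    · intro h j
      rcases (ha j).eq_or_lt with h0 | h0
      · rw [← h0, zero_mul]; exact hy.le
      · have := h (e.symm ⟨j, h0⟩)
        rw [Equiv.apply_symm_apply, le_div_iff₀' h0] at this
        exact this
  rw [hset, hcdf _ (fun k => t (e k)) (fun k => y / a (e k)) fun k => div_pos hy (e k).2,
    ← integral_mul_const (y ^ (-α))]
  congr 3
  refine integral_congr_ae ?_
  filter_upwards [hnn, ae_all_iff.2 fun j => (hg (t j)).2] with s hs hgs
  have : ⨆ k, g (t (e k)) s / (y / a (e k)) = (⨆ j, a j * g (t j) s) / y := by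
    refine le_antisymm (Real.iSup_le (fun k => ?_) (div_nonneg hs hy.le)) ?_
    · rw [div_div_eq_mul_div, mul_comm]
      exact div_le_div_of_nonneg_right (le_ciSup (f := fun j => a j * g (t j) s)
        (finite_range _).bddAbove _) hy.le
    · have hbdd := (finite_range fun k => g (t (e k)) s / (y / a (e k))).bddAbove
      have h0 : 0 ≤ ⨆ k, g (t (e k)) s / (y / a (e k)) :=
        Real.iSup_nonneg fun k => div_nonneg (hgs _) (div_pos hy (e k).2).le
      rw [div_le_iff₀ hy]
      refine Real.iSup_le (fun j => ?_) (mul_nonneg h0 hy.le)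
      rcases (ha j).eq_or_lt with h1 | h1
      · rw [← h1, zero_mul]; exact mul_nonneg h0 hy.le
      · rw [← div_le_iff₀ hy]
        refine le_trans (le_of_eq ?_) (le_ciSup hbdd (e.symm ⟨j, h1⟩))
        rw [Equiv.apply_symm_apply, div_div_eq_mul_div, mul_comm]
  simp only [this]
  rw [Real.div_rpow hs hy.le, Real.rpow_neg hy.le, div_eq_mul_inv]

/-- The process on the path space `T → [0, ∞]` that turns extremal integrals of `g_t^α` of
index `1` into extremal integrals of `g_t` of index `α`: the coordinate at `t` to the power `1/α`,
where the null event that the coordinate is `∞` is sent to `0`. -/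
noncomputable def extremalProcess {T : Type*} (α : ℝ) (t : T) (ω : T → ℝ≥0∞) : ℝ :=
  (ω t ^ α⁻¹).toReal

/-- For nonnegative spectral functions there is a process of extremal integrals. -/
theorem exists_hasExtremalRepresentation {T S : Type*} [MeasurableSpace S] {α : ℝ} (hα0 : 0 < α)
    {μ : Measure S} {g : T → S → ℝ} (hm : ∀ t, Measurable (g t)) (hg0 : ∀ t s, 0 ≤ g t s)
    (hg : ∀ t, MemLp (g t) (ENNReal.ofReal α) μ) :
    ∃ Q : Measure (T → ℝ≥0∞), IsProbabilityMeasure Q ∧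
      HasExtremalRepresentation α (extremalProcess α) Q g μ := by
  classical
  obtain ⟨Q, hQ, hQb⟩ := exists_extremalIntegral μ (h := fun t s => ‖g t s‖₊ ^ α)
    (fun t => by have := hm t; fun_prop) (fun t => lintegral_nnnorm_rpow_ne_top hα0 (hg t))
  have hmeas (t : T) : Measurable (extremalProcess (T := T) α t) := by
    unfold extremalProcess; fun_prop
  have hfin (t : T) : ∀ᵐ ω ∂Q, ω t ≠ ∞ := by
    set c := ∫⁻ s, ((‖g t s‖₊ ^ α : ℝ≥0) : ℝ≥0∞) ∂μ with hc
    have hct : c ≠ ∞ := lintegral_nnnorm_rpow_ne_top hα0 (hg t)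
    have hb (n : ℕ) : expNeg (c / n) ≤ Q {ω | ω t ≠ ∞} := by
      have hn := hQb {t} fun _ => (n : ℝ≥0∞)
      simp only [Finset.mem_singleton, forall_eq, iSup_iSup_eq_left, div_eq_mul_inv] at hn
      rw [lintegral_mul_const _ (by have := hm t; fun_prop), ← div_eq_mul_inv] at hn
      rw [← hn]
      exact measure_mono fun ω hω => ne_top_of_le_ne_top (ENNReal.natCast_ne_top n) hω
    have hlim : Tendsto (fun n : ℕ => expNeg (c / n)) atTop (𝓝 1) := by
      have : Tendsto (fun n : ℕ => c / n) atTop (𝓝 0) := by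
        have := ENNReal.Tendsto.const_div (a := c) ENNReal.tendsto_nat_nhds_top (Or.inr hct)
        simpa using this
      simpa [Function.comp_def] using (continuous_expNeg.tendsto 0).comp this
    have h1 : Q {ω | ω t ≠ ∞} = 1 := le_antisymm prob_le_one (le_of_tendsto' hlim hb)
    have hms : MeasurableSet {ω : T → ℝ≥0∞ | ω t ≠ ∞} :=
      (measurableSet_singleton ∞).compl.preimage (measurable_pi_apply t)
    exact (prob_compl_eq_zero_iff hms).2 h1
  refine ⟨Q, hQ, fun t => ⟨(hmeas t).aemeasurable, Eventually.of_forall fun ω =>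
    ENNReal.toReal_nonneg⟩, fun t => ⟨hg t, Eventually.of_forall (hg0 t)⟩, fun n t a ha => ?_⟩
  set c : Fin n → ℝ≥0∞ := fun j => ENNReal.ofReal (a j) ^ α with hc
  -- a repeated index has to satisfy the strongest of its constraints
  set b : T → ℝ≥0∞ := fun i => ⨅ j, ⨅ _ : t j = i, c j with hb
  have hset : {ω | ∀ j, extremalProcess α (t j) ω ≤ a j} =ᵐ[Q]
      {ω | ∀ i ∈ Finset.univ.image t, ω i ≤ b i} := by
    refine eventuallyEq_set.2 ?_
    filter_upwards [ae_all_iff.2 fun j => hfin (t j)] with ω hω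
    have h1 (j : Fin n) : extremalProcess α (t j) ω ≤ a j ↔ ω (t j) ≤ c j := by
      rw [extremalProcess, ← ENNReal.le_ofReal_iff_toReal_le
        (ENNReal.rpow_ne_top_of_nonneg (inv_nonneg.2 hα0.le) (hω j)) (ha j).le,
        ENNReal.rpow_inv_le_iff hα0]
    simp only [h1, Finset.mem_image, Finset.mem_univ, true_and, forall_exists_index,
      forall_apply_eq_imp_iff, hb, le_iInf_iff]
    exact ⟨fun h i j hj => hj ▸ h j, fun h j => h j j rfl⟩
  rw [measure_congr hset, hQb]
  have hdiv (j : Fin n) (s : S) : ((‖g (t j) s‖₊ ^ α : ℝ≥0) : ℝ≥0∞) / c j =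
      ENNReal.ofReal ((g (t j) s / a j) ^ α) := by
    rw [ENNReal.coe_rpow_of_nonneg _ hα0.le, hc, ← ENNReal.div_rpow_of_nonneg _ _ hα0.le,
      ← ENNReal.ofReal_rpow_of_nonneg (div_nonneg (hg0 _ _) (ha j).le) hα0.le,
      ENNReal.ofReal_div_of_pos (ha j), ← Real.enorm_of_nonneg (hg0 _ _)]
    rfl
  have hle (j : Fin n) (s : S) : (g (t j) s / a j) ^ α ≤ (⨆ j, g (t j) s / a j) ^ α :=
    Real.rpow_le_rpow (div_nonneg (hg0 _ _) (ha j).le)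
      (le_ciSup (f := fun j => g (t j) s / a j) (finite_range _).bddAbove j) hα0.le
  have hnn (s : S) : 0 ≤ (⨆ j, g (t j) s / a j) ^ α :=
    Real.rpow_nonneg (Real.iSup_nonneg fun j => div_nonneg (hg0 _ _) (ha j).le) _
  have hsup (s : S) : ⨆ i ∈ Finset.univ.image t, ((‖g i s‖₊ ^ α : ℝ≥0) : ℝ≥0∞) / b i =
      ENNReal.ofReal ((⨆ j, g (t j) s / a j) ^ α) := by
    simp only [hb, div_eq_mul_inv, ENNReal.inv_iInf, ENNReal.mul_iSup]
    simp only [← div_eq_mul_inv]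
    refine le_antisymm ?_ ?_
    · refine iSup₂_le fun i _ => iSup₂_le fun j hj => ?_
      subst hj
      rw [hdiv]
      exact ENNReal.ofReal_le_ofReal (hle j s)
    · rcases isEmpty_or_nonempty (Fin n) with he | he
      · simp [Real.iSup_of_isEmpty, Real.zero_rpow hα0.ne']
      · obtain ⟨j, hj⟩ := exists_eq_ciSup_of_finite (f := fun j => g (t j) s / a j)
        rw [← hj, ← hdiv]
        exact le_iSup₂_of_le (t j) (by simp) (le_iSup₂_of_le j rfl le_rfl)
  have hsm : Measurable fun s => (⨆ j, g (t j) s / a j) ^ α :=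
    (Measurable.iSup fun j => (hm (t j)).div_const (a j)).pow_const α
  have hint : Integrable (fun s => (⨆ j, g (t j) s / a j) ^ α) μ := by
    have hi (j : Fin n) : Integrable (fun s => (g (t j) s / a j) ^ α) μ := by
      have := integrable_abs_rpow hα0 ((hg (t j)).mul_const (a j)⁻¹)
      refine this.congr (Eventually.of_forall fun s => ?_)
      simp only
      rw [← div_eq_mul_inv, abs_of_nonneg (div_nonneg (hg0 _ _) (ha j).le)]
    refine (integrable_finsetSum Finset.univ fun j _ => hi j).mono' hsm.aestronglyMeasurable
      (Eventually.of_forall fun s => ?_)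
    rw [Real.norm_of_nonneg (hnn s)]
    have hpos (j : Fin n) : 0 ≤ (g (t j) s / a j) ^ α :=
      Real.rpow_nonneg (div_nonneg (hg0 _ _) (ha j).le) _
    rcases isEmpty_or_nonempty (Fin n) with he | he
    · simp [Real.iSup_of_isEmpty, Real.zero_rpow hα0.ne']
    · obtain ⟨j, hj⟩ := exists_eq_ciSup_of_finite (f := fun j => g (t j) s / a j)
      rw [← hj]
      exact Finset.single_le_sum (f := fun j => (g (t j) s / a j) ^ α) (fun j _ => hpos j)
        (Finset.mem_univ j)
  simp only [hsup]
  rw [← ofReal_integral_eq_lintegral_ofReal hint (Eventually.of_forall hnn),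
    expNeg_ofReal (integral_nonneg hnn)]

/-! ### Association of stable and Fréchet processes -/

/-- Two stable representations of the same process have the same `L^α` norms of linear
combinations. -/
lemma HasStableRepresentation.integral_eq {T Ω S S' : Type*} [MeasurableSpace Ω]
    [MeasurableSpace S] [MeasurableSpace S'] {α : ℝ} {X : T → Ω → ℝ} {P : Measure Ω}
    {f : T → S → ℝ} {μ : Measure S} {g : T → S' → ℝ} {μ' : Measure S'}
    (hf : HasStableRepresentation α X P f μ) (hg : HasStableRepresentation α X P g μ')
    (t₁ t₂ : T) (a b : ℝ) :
    ∫ s, |a * f t₁ s + b * f t₂ s| ^ α ∂μ = ∫ s, |a * g t₁ s + b * g t₂ s| ^ α ∂μ' := by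
  have h := (hf.2.2 2 ![t₁, t₂] ![a, b]).symm.trans (hg.2.2 2 ![t₁, t₂] ![a, b])
  have h := Real.exp_injective (Complex.ofReal_injective h)
  simpa using h

/-- If the spectral functions have pairwise equal signs, their absolute values represent a process
associated with `X`. -/
theorem HasStableRepresentation.isMaxAssociable {T : Type v₁} {Ω : Type v₂} {S : Type u}
    [MeasurableSpace Ω] [MeasurableSpace S] {α : ℝ} (hα0 : 0 < α) {X : T → Ω → ℝ} {P : Measure Ω}
    {f : T → S → ℝ} {μ : Measure S} (hX : HasStableRepresentation α X P f μ)
    (hf : ∀ t₁ t₂, ∀ᵐ s ∂μ, 0 ≤ f t₁ s * f t₂ s) : IsMaxAssociable.{max u w, v₁, v₂} α X P := by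
  obtain ⟨hXm, hfm, hchar⟩ := hX
  have hmk t := (hfm t).1.ae_eq_mk
  set m : T → S → ℝ := fun t => (hfm t).1.mk (f t) with hm_def
  have hm t : Measurable (m t) := (hfm t).1.stronglyMeasurable_mk.measurable
  set g : T → ULift.{w} S → ℝ := fun t s => |m t s.down| with hg_def
  have hpres := measurePreserving_uliftDown.{u, w} μ
  have hgm t : Measurable (g t) :=
    _root_.continuous_abs.measurable.comp ((hm t).comp hpres.measurable)
  have hgL t : MemLp (g t) (ENNReal.ofReal α) (uliftMeasure μ) :=
    (((hfm t).ae_eq (hmk t)).comp_measurePreserving hpres).norm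
  have hg0 t s : 0 ≤ g t s := abs_nonneg _
  obtain ⟨Q, hQ, hQr⟩ := exists_hasExtremalRepresentation hα0 hgm hg0 hgL
  refine ⟨T → ℝ≥0∞, inferInstance, Q, extremalProcess α, hQ, hQr.isFrechetProcess hα0,
    ULift.{w} S, inferInstance, uliftMeasure μ, g, hQr.2.1, ⟨hXm, hgL, fun n t a => ?_⟩, hQr⟩
  rw [hchar]
  congr 3
  have h1 : ∫ s, |∑ j, a j * g (t j) s| ^ α ∂uliftMeasure.{u, w} μ =
      ∫ s, |(∑ j, a j * |m (t j) s|)| ^ α ∂μ :=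
    hpres.integral_comp MeasurableEquiv.ulift.measurableEmbedding
      (fun s => |(∑ j, a j * |m (t j) s|)| ^ α)
  rw [h1]
  refine integral_congr_ae ?_
  filter_upwards [ae_all_iff.2 fun j => hmk (t j),
    ae_all_iff.2 fun i => ae_all_iff.2 fun j => hf (t i) (t j)] with s hs hsign
  simp only [hm_def, ← hs]
  rw [abs_sum_mul_abs hsign]

theorem theorem4p2 (α : ℝ) (hα0 : 0 < α) (hα2 : α < 2) :
    (∀ (n : ℕ) (S₁ : Type u) [MeasurableSpace S₁] (μ₁ : Measure S₁) (f : Fin n → S₁ → ℝ),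
      (∀ j, MemLp (f j) (ENNReal.ofReal α) μ₁) →
        ((∃ (S₂ : Type (max u w)) (_ : MeasurableSpace S₂) (μ₂ : Measure S₂)
              (g : Fin n → S₂ → ℝ),
            IsNonnegLpFamily α μ₂ g ∧ SameLinearNorms α μ₁ f μ₂ g) ↔
          ∀ i j, ∀ᵐ s ∂μ₁, 0 ≤ f i s * f j s) ∧
        ((∀ i j, ∀ᵐ s ∂μ₁, 0 ≤ f i s * f j s) →
          IsNonnegLpFamily α μ₁ (fun j s => |f j s|) ∧
            SameLinearNorms α μ₁ f μ₁ (fun j s => |f j s|))) ∧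
    (∀ (T : Type v₁) (Ω : Type v₂) [MeasurableSpace Ω] (P : Measure Ω) [IsProbabilityMeasure P]
        (X : T → Ω → ℝ) (S : Type u) [MeasurableSpace S] (μ : Measure S) (f : T → S → ℝ),
      IsSymmStableProcess α X P → HasStableRepresentation α X P f μ →
        (IsMaxAssociable.{max u w, v₁, v₂} α X P ↔
          ∀ t₁ t₂, ∀ᵐ s ∂μ, 0 ≤ f t₁ s * f t₂ s)) := by
  refine ⟨fun n S₁ _ μ₁ f hf => ⟨⟨?_, fun h => ?_⟩,
    fun h => ⟨isNonnegLpFamily_abs hf, sameLinearNorms_abs h⟩⟩,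
    fun T Ω _ P _ X S _ μ f _ hX => ⟨?_, fun h => hX.isMaxAssociable hα0 h⟩⟩
  · rintro ⟨S₂, _, μ₂, g, hg, h⟩ i j
    exact ae_mul_nonneg_of_sameLinearNorms hα0 hα2 hf hg h i j
  · have hpres := measurePreserving_uliftDown.{u, w} μ₁
    refine ⟨ULift.{w} S₁, inferInstance, uliftMeasure μ₁, fun j s => |f j s.down|, fun j =>
      ⟨((hf j).comp_measurePreserving hpres).norm, Eventually.of_forall fun _ => abs_nonneg _⟩,
      fun a => ?_⟩
    rw [sameLinearNorms_abs h a]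
    have hL : MemLp (fun s => ∑ j, a j * |f j s|) (ENNReal.ofReal α) μ₁ :=
      memLp_finsetSum _ fun j _ => ((hf j).norm).const_mul (a j)
    exact (eLpNorm_comp_measurePreserving hL.1 hpres).symm
  · rintro ⟨Ω', _, P', Y, _, _, S', _, μ', g, hg, hXg, _⟩ t₁ t₂
    refine ae_mul_nonneg_of_integral_eq hα0 hα2 (hX.2.1 t₁) (hX.2.1 t₂) (hg t₁).1 (hg t₂).1
      (hX.integral_eq hXg t₁ t₂) ?_
    filter_upwards [(hg t₁).2, (hg t₂).2] with s h1 h2 using mul_nonneg h1 h2
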